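/- **Prepare-and-measure behaviours.** Let $\mathcal Q\subset\mathbb R^4$ be the set of tuples $(\mathbf E,\boldsymbol\omega)=(E_1,E_2,\omega_1,\omega_2)$ that are (finite) convex combinations of tuples for which there exist a complex Hilbert space (of arbitrary dimension), two density operators $\rho_1,\rho_2$ on it, a self-adjoint operator $M$ with $-1\le M\le 1$, and a (possibly unbounded) self-adjoint operator $O$ whose spectrum is contained in $\{0\}\cup[1,\infty)$ and for which $0$ is a nondegenerate eigenvalue, such that $$\operatorname{Tr}[\rho_xM]=E_x,\qquad \operatorname{Tr}[\rho_xO]\le\omega_x\qquad(x=1,2).$$ **Bell behaviours.** Let $\mathcal Q_{Bell}\subset\mathbb R^4$ be the set of tuples $(\langle A_xB_y\rangle)_{x,y\in\{1,2\}}$ of the form $\langle A_xB_y\rangle=\operatorname{Tr}[\rho_{AB}\,(A_x\otimes B_y)]$, where $\rho_{AB}$ is a density operator on a tensor product $\mathcal H_A\otimes\mathcal H_B$ of complex Hilbert spaces (of arbitrary dimension), and $A_1,A_2$ on $\mathcal H_A$ and $B_1,B_2$ on $\mathcal H_B$ are self-adjoint operators with $A_x^2=1$, $B_y^2=1$. **Proposition.**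 For $E_1,E_2,\omega_1,\omega_2\in\mathbb R$, the tuple $(\mathbf E,\boldsymbol\omega)$ is in $\mathcal Q$ if and only if there exists a Bell behaviour $(\langle A_xB_y\rangle)_{x,y}\in\mathcal Q_{Bell}$ such that, for $x=1,2$, $$\langle A_xB_1\rangle=E_x,\qquad \langle A_xB_2\rangle\le 2\omega_x-1 .$$ -/

import Mathlib

universe u v w

open scoped TensorProduct InnerProductSpace

namespace EnergyCorrelations

section Operators

variable {H : Type u} [NormedAddCommGroup H] [InnerProductSpace ℂ H] [CompleteSpace H]

/-- `HasTrace T t`: for every orthonormal Hilbert basis `(e i)` of `H`, the family `⟪e i, T (e i)⟫`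
is (unconditionally) summable with sum `t`. Equivalently, `T` is trace class and `Tr T = t`. Every
orthonormal Hilbert basis is, up to relabelling, indexed by a subset of `H`. -/
def HasTrace (T : H →L[ℂ] H) (t : ℂ) : Prop :=
  ∀ (s : Set H) (e : HilbertBasis s ℂ H), HasSum (fun i => ⟪e i, T (e i)⟫_ℂ) t

/-- A (possibly mixed) quantum state, i.e. a density operator: positive, with trace one. -/
structure IsState (ρ : H →L[ℂ] H) : Prop where
  isPositive : ρ.IsPositive
  hasTrace_one : HasTrace ρ 1

/-- The spectrum of a closed, possibly unbounded, operator `O`: the complex numbers `z` for which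
`O - z`, from the domain of `O` to `H`, is not bijective. -/
def unboundedSpectrum (O : H →ₗ.[ℂ] H) : Set ℂ :=
  {z | ¬ Function.Bijective (fun ψ : O.domain => O ψ - z • (ψ : H))}

/-- An energy observable: a self-adjoint, possibly unbounded, operator whose lowest spectral value
is the nondegenerate eigenvalue `0` and whose other spectral values are real and at least `1`. -/
structure IsEnergyObservable (O : H →ₗ.[ℂ] H) : Prop where
  isSelfAdjoint : IsSelfAdjoint O
  gap : ∀ z ∈ unboundedSpectrum O, z = 0 ∨ ∃ r : ℝ, 1 ≤ r ∧ z = r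
  vacuum : Module.finrank ℂ (LinearMap.ker O.toFun) = 1

/-- The expectation value `Tr[ρ O] ∈ [0, ∞]` of a nonnegative, possibly unbounded, self-adjoint
operator `O` in the state `ρ`: the supremum of `Tr[ρ B]` over the bounded operators `B` with
`0 ≤ B ≤ O` in the sense of quadratic forms. For bounded `O` this is `Tr[ρ O]`; in general it is
the limit of `Tr[ρ Oₙ]` for bounded truncations `Oₙ` increasing to `O`, such as
`Oₙ = O (1 + O / n)⁻¹`. -/
noncomputable def meanEnergy (ρ : H →L[ℂ] H) (O : H →ₗ.[ℂ] H) : EReal :=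
  sSup {t : EReal | ∃ (B : H →L[ℂ] H) (r : ℝ), 0 ≤ B ∧
    (∀ ψ : O.domain, (⟪(ψ : H), B ψ⟫_ℂ).re ≤ (⟪(ψ : H), O ψ⟫_ℂ).re) ∧
    HasTrace (ρ * B) (r : ℂ) ∧ t = (r : EReal)}

end Operators

/-- The behaviours `(E, ω)` realised by two states `ρ x`, an observable `-1 ≤ M ≤ 1` and an energy
observable `O` on some complex Hilbert space, without shared randomness: `Tr[ρ x M] = E x` and
`Tr[ρ x O] ≤ ω x`. The two inputs are indexed by `Fin 2`. -/
def realizableBehaviours : Set ((Fin 2 → ℝ) × (Fin 2 → ℝ)) :=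
  {p | ∃ (H : Type u) (_ : NormedAddCommGroup H) (_ : InnerProductSpace ℂ H) (_ : CompleteSpace H)
    (ρ : Fin 2 → H →L[ℂ] H) (M : H →L[ℂ] H) (O : H →ₗ.[ℂ] H),
    (∀ x, IsState (ρ x)) ∧ IsSelfAdjoint M ∧ -1 ≤ M ∧ M ≤ 1 ∧ IsEnergyObservable O ∧
    (∀ x, HasTrace (ρ x * M) (p.1 x : ℂ)) ∧ ∀ x, meanEnergy (ρ x) O ≤ (p.2 x : EReal)}

/-- The set `𝒬` of prepare-and-measure behaviours `(E, ω)` admitting a quantum representation: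
convex combinations (shared randomness) of realisable behaviours. -/
def quantumSet : Set ((Fin 2 → ℝ) × (Fin 2 → ℝ)) :=
  convexHull ℝ realizableBehaviours.{u}

/-- The Hilbert space tensor product. -/
abbrev HilbertTensor (HA : Type v) (HB : Type w) [NormedAddCommGroup HA] [InnerProductSpace ℂ HA]
    [NormedAddCommGroup HB] [InnerProductSpace ℂ HB] : Type (max v w) :=
  UniformSpace.Completion (HA ⊗[ℂ] HB)

/-- The bounded operator `A ⊗ B` on the Hilbert space tensor product. -/
noncomputable def tensorOp {HA : Type v} {HB : Type w} [NormedAddCommGroup HA]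
    [InnerProductSpace ℂ HA] [NormedAddCommGroup HB] [InnerProductSpace ℂ HB]
    (A : HA →L[ℂ] HA) (B : HB →L[ℂ] HB) : HilbertTensor HA HB →L[ℂ] HilbertTensor HA HB :=
  (TensorProduct.mapL A B).completion

/-- The set of quantum Bell behaviours `C x y = ⟨A x B y⟩ = Tr[ρ (A x ⊗ B y)]` in the bipartite
scenario with two binary (`±1`-valued) measurements per party; inputs are indexed by `Fin 2`. -/
def bellQuantumSet : Set (Fin 2 → Fin 2 → ℝ) :=
  {C | ∃ (HA : Type v) (_ : NormedAddCommGroup HA) (_ : InnerProductSpace ℂ HA)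
    (_ : CompleteSpace HA)
    (HB : Type w) (_ : NormedAddCommGroup HB) (_ : InnerProductSpace ℂ HB) (_ : CompleteSpace HB)
    (ρ : HilbertTensor HA HB →L[ℂ] HilbertTensor HA HB)
    (A : Fin 2 → HA →L[ℂ] HA) (B : Fin 2 → HB →L[ℂ] HB),
    IsState ρ ∧ (∀ x, IsSelfAdjoint (A x) ∧ A x ^ 2 = 1) ∧ (∀ y, IsSelfAdjoint (B y) ∧ B y ^ 2 = 1) ∧
    ∀ x y, HasTrace (ρ * tensorOp (A x) (B y)) (C x y : ℂ)}

end EnergyCorrelations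

/-! Both sides are equivalent to membership in `gramSet`: unit vectors `b₀`, `b₁` shared by the two
inputs and, for each input separately, a unit vector with overlap `E x` on `b₀` and at most `2 ω x -
1` on `b₁`. The overlap of the two input vectors is unconstrained, so one 3×3 Gram matrix per input
suffices, linked only by the common entry `c`.

From Bell, positivity of squares of combinations of `A x ⊗ 1`, `1 ⊗ B 0`, `1 ⊗ B 1` gives these
matrices, and `c` comes from the anticommutator of Bob's observables (`mem_gramSet_of_bell`).

From prepare-and-measure, the gap gives `O ≥ 1 - P` with `P` the vacuum projection
(`IsEnergyObservable.exists_vacuum`). The obvious second observable `1 - 2P` has an overlap with `M`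
that may depend on the state, so `c` would not be shared. `alignedObservable` lies below `1 - 2P`
and admits the overlap `-⟪φ, M φ⟫` in every state (`realizableBehaviours_subset_gramSet`). Shared
randomness adds nothing, since `gramSet` is convex.

Conversely, Gram data are realised by pure qubit states (`gramSet_subset_quantumSet`) and by a
maximally entangled qubit pair (`exists_bell_of_mem_gramSet`). -/

namespace EnergyCorrelations

/-! ### Traces and states as positive functionals -/

section Trace

variable {H : Type u} [NormedAddCommGroup H] [InnerProductSpace ℂ H]

/-- Parseval, stated in `ENNReal` so that double sums can be exchanged without summability
conditions. -/
lemma ofReal_norm_sq_eq_tsum {ι : Type*} (e : HilbertBasis ι ℂ H) (x : H) :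
    ENNReal.ofReal (‖x‖ ^ 2) = ∑' i, ENNReal.ofReal (‖⟪e i, x⟫_ℂ‖ ^ 2) := by
  have h : HasSum (fun i => ‖⟪e i, x⟫_ℂ‖ ^ 2) (‖x‖ ^ 2) := by
    have h₁ := (Complex.hasSum_iff _ _).1 (e.hasSum_inner_mul_inner x x)
    convert h₁.1 using 1
    · funext i
      rw [← inner_conj_symm x (e i), ← Complex.normSq_eq_conj_mul_self, Complex.normSq_eq_norm_sq]
      norm_cast
    · rw [← inner_self_eq_norm_sq (𝕜 := ℂ)]; rfl
  rw [← h.tsum_eq, ENNReal.ofReal_tsum_of_nonneg (fun _ => by positivity) h.summable]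

lemma re_inner_eq_norm_sq_sub (x y : H) :
    (⟪x, y⟫_ℂ).re = (‖x + y‖ ^ 2 - ‖x - y‖ ^ 2) / 4 := by
  have h₁ := norm_add_sq (𝕜 := ℂ) x y
  have h₂ := norm_sub_sq (𝕜 := ℂ) x y
  simp only [RCLike.re_to_complex] at h₁ h₂
  linarith

lemma abs_re_inner_apply_le (T : H →L[ℂ] H) (v : H) :
    |(⟪v, T v⟫_ℂ).re| ≤ ‖T‖ * ‖v‖ ^ 2 := by
  calc |(⟪v, T v⟫_ℂ).re| ≤ ‖⟪v, T v⟫_ℂ‖ := Complex.abs_re_le_norm _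
    _ ≤ ‖v‖ * ‖T v‖ := norm_inner_le_norm _ _
    _ ≤ ‖v‖ * (‖T‖ * ‖v‖) := by gcongr; exact T.le_opNorm v
    _ = _ := by ring

lemma HasTrace.sub {S T : H →L[ℂ] H} {s t : ℂ} (hS : HasTrace S s) (hT : HasTrace T t) :
    HasTrace (S - T) (s - t) := fun w e => by
  simpa [inner_sub_right] using (hS w e).sub (hT w e)

lemma hasTrace_mul_rankOne (x y : H) (T : H →L[ℂ] H) :
    HasTrace (T * InnerProductSpace.rankOne ℂ x y) ⟪y, T x⟫_ℂ := fun w e => by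
  refine (congrArg (HasSum · _) (funext fun i => ?_)).mp (e.hasSum_inner_mul_inner y (T x))
  rw [mul_apply_eq_comp, InnerProductSpace.rankOne_apply, map_smul, inner_smul_right]

lemma isState_rankOne {x : H} (hx : ‖x‖ = 1) : IsState (InnerProductSpace.rankOne ℂ x x) where
  isPositive := InnerProductSpace.isPositive_rankOne_self x
  hasTrace_one := by
    have := hasTrace_mul_rankOne x x (1 : H →L[ℂ] H)
    simpa [hx] using this

variable [CompleteSpace H]

/-- The Hilbert–Schmidt norms of an operator and of its adjoint agree. -/
lemma tsum_norm_sq_adjoint {ι : Type*} (e : HilbertBasis ι ℂ H) (S : H →L[ℂ] H) :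
    ∑' i, ENNReal.ofReal (‖ContinuousLinearMap.adjoint S (e i)‖ ^ 2) =
      ∑' i, ENNReal.ofReal (‖S (e i)‖ ^ 2) := by
  simp_rw [ofReal_norm_sq_eq_tsum e (_)]
  rw [ENNReal.tsum_comm]
  refine tsum_congr fun i => tsum_congr fun j => ?_
  rw [ContinuousLinearMap.adjoint_inner_right, ← inner_conj_symm, RCLike.norm_conj]

lemma hasSum_norm_sq_adjoint {ι : Type*} (e : HilbertBasis ι ℂ H) {S : H →L[ℂ] H} {t : ℝ}
    (h : HasSum (fun i => ‖S (e i)‖ ^ 2) t) :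
    HasSum (fun i => ‖ContinuousLinearMap.adjoint S (e i)‖ ^ 2) t := by
  have ht : 0 ≤ t := h.nonneg fun _ => by positivity
  have h₁ : ∑' i, ENNReal.ofReal (‖ContinuousLinearMap.adjoint S (e i)‖ ^ 2)
      = ENNReal.ofReal t := by
    rw [tsum_norm_sq_adjoint, ← h.tsum_eq,
      ENNReal.ofReal_tsum_of_nonneg (fun _ => by positivity) h.summable]
  have h₂ := ENNReal.hasSum_toReal (h₁ ▸ ENNReal.ofReal_ne_top)
  rw [← ENNReal.tsum_toReal_eq (fun _ => ENNReal.ofReal_ne_top), h₁,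
    ENNReal.toReal_ofReal ht] at h₂
  simpa [ENNReal.toReal_ofReal] using h₂

/-- The real part of `Tr[ρ T]`, for `ρ = A²` with `A` self-adjoint and Hilbert–Schmidt, may be
computed as the real part of `Tr[A T A]`. -/
lemma hasSum_re_inner_conj {ι : Type*} (e : HilbertBasis ι ℂ H) {A T : H →L[ℂ] H}
    (hA : IsSelfAdjoint A) (hs : Summable fun i => ‖A (e i)‖ ^ 2) {t : ℝ}
    (ht : HasSum (fun i => (⟪e i, (A * A * T) (e i)⟫_ℂ).re) t) :
    HasSum (fun i => (⟪A (e i), T (A (e i))⟫_ℂ).re) t := by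
  have hA' : ContinuousLinearMap.adjoint A = A := hA
  -- Polarization: `A ± T* A` has adjoint `A ± A T`, and the difference of squared norms is four
  -- times the wanted term on either side. Equality of Hilbert–Schmidt norms then moves `A` across
  -- `T`.
  have key : ∀ c : ℝ, Summable fun i => ‖(A + c • (ContinuousLinearMap.adjoint T * A)) (e i)‖ ^ 2 := by
    intro c
    refine Summable.of_nonneg_of_le (fun _ => by positivity) (fun i => ?_)
      (hs.mul_left (‖1 + c • ContinuousLinearMap.adjoint T‖ ^ 2))
    have : (A + c • (ContinuousLinearMap.adjoint T * A)) (e i)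
        = (1 + c • ContinuousLinearMap.adjoint T) (A (e i)) := by simp
    rw [this, ← mul_pow]
    gcongr
    exact ContinuousLinearMap.le_opNorm _ _
  have hadj : ∀ c : ℝ, ContinuousLinearMap.adjoint (A + c • (ContinuousLinearMap.adjoint T * A))
      = A + c • (A * T) := by
    intro c
    change star (A + c • (star T * A)) = _
    simp [hA.star_eq]
  obtain ⟨p, hp⟩ := key 1
  obtain ⟨q, hq⟩ := key (-1)
  have hp' := hasSum_norm_sq_adjoint e hp
  have hq' := hasSum_norm_sq_adjoint e hq
  rw [hadj] at hp' hq'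
  have h₁ := (hp.sub hq).div_const 4
  have h₂ := (hp'.sub hq').div_const 4
  have e₁ : ∀ i, (⟪A (e i), T (A (e i))⟫_ℂ).re
      = (‖(A + (1 : ℝ) • (ContinuousLinearMap.adjoint T * A)) (e i)‖ ^ 2
        - ‖(A + (-1 : ℝ) • (ContinuousLinearMap.adjoint T * A)) (e i)‖ ^ 2) / 4 := by
    intro i
    rw [← ContinuousLinearMap.adjoint_inner_left, ← inner_conj_symm, Complex.conj_re,
      re_inner_eq_norm_sq_sub]
    simp [sub_eq_add_neg]
  have e₂ : ∀ i, (⟪e i, (A * A * T) (e i)⟫_ℂ).re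
      = (‖(A + (1 : ℝ) • (A * T)) (e i)‖ ^ 2 - ‖(A + (-1 : ℝ) • (A * T)) (e i)‖ ^ 2) / 4 := by
    intro i
    rw [mul_assoc, mul_apply_eq_comp, ← hA', ContinuousLinearMap.adjoint_inner_right,
      hA', re_inner_eq_norm_sq_sub]
    simp [sub_eq_add_neg]
  simp_rw [e₁]
  simp_rw [e₂] at ht
  rwa [ht.unique h₂]

/-- A state induces a positive linear functional that computes all traces `Tr[ρ T]`. -/
theorem IsState.exists_expectation {ρ : H →L[ℂ] H} (hρ : IsState ρ) :
    ∃ g : (H →L[ℂ] H) →ₗ[ℝ] ℝ, (∀ T, (∀ v, 0 ≤ (⟪v, T v⟫_ℂ).re) → 0 ≤ g T) ∧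
      ∀ (T : H →L[ℂ] H) (t : ℝ), HasTrace (ρ * T) (t : ℂ) → g T = t := by
  obtain ⟨w, e, -⟩ := exists_hilbertBasis ℂ H
  have h0 : 0 ≤ ρ := (ContinuousLinearMap.nonneg_iff_isPositive ρ).2 hρ.isPositive
  -- The form `Tr[A T A]` converges absolutely for every bounded `T` and is positive term by term,
  -- neither of which is evident for `Tr[ρ T]`.
  set A := CFC.sqrt ρ
  have hA : IsSelfAdjoint A := IsSelfAdjoint.of_nonneg (CFC.sqrt_nonneg ρ)
  have hAA : A * A = ρ := CFC.sqrt_mul_sqrt_self ρ h0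
  have hA' : ContinuousLinearMap.adjoint A = A := hA
  have hs : Summable fun i => ‖A (e i)‖ ^ 2 := by
    refine ((Complex.hasSum_iff _ _).1 (hρ.hasTrace_one w e)).1.summable.congr fun i => ?_
    rw [← hAA, mul_apply_eq_comp, ← hA', ContinuousLinearMap.adjoint_inner_right, hA',
      ← inner_self_eq_norm_sq (𝕜 := ℂ)]
    rfl
  have hsT : ∀ T : H →L[ℂ] H, Summable fun i => (⟪A (e i), T (A (e i))⟫_ℂ).re := fun T =>
    Summable.of_norm_bounded (hs.mul_left ‖T‖) fun i => abs_re_inner_apply_le T _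
  refine ⟨{ toFun := fun T => ∑' i, (⟪A (e i), T (A (e i))⟫_ℂ).re
            map_add' := fun S T => ?_
            map_smul' := fun c T => ?_ }, fun T hT => ?_, fun T t ht => ?_⟩
  · rw [← (hsT S).tsum_add (hsT T)]
    simp
  · simp [inner_smul_right_eq_smul, tsum_mul_left]
  · exact tsum_nonneg fun i => hT _
  · refine (hasSum_re_inner_conj e hA hs ?_).tsum_eq
    rw [hAA]
    simpa using ((Complex.hasSum_iff _ _).1 (ht w e)).1

lemma hasTrace_rankOne_mul (x y : H) (T : H →L[ℂ] H) :
    HasTrace (InnerProductSpace.rankOne ℂ x y * T) ⟪y, T x⟫_ℂ := fun w e => by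
  rw [← ContinuousLinearMap.adjoint_inner_left]
  refine (congrArg (HasSum · _) (funext fun i => ?_)).mp
    (e.hasSum_inner_mul_inner (ContinuousLinearMap.adjoint T y) x)
  rw [mul_apply_eq_comp, InnerProductSpace.rankOne_apply, inner_smul_right,
    ContinuousLinearMap.adjoint_inner_left]

end Trace

/-! ### Energy observables and their vacuum -/

section Energy

variable {H : Type u} [NormedAddCommGroup H] [InnerProductSpace ℂ H]

/-- The operator `1 - |φ⟩⟨φ|` as an everywhere defined energy observable. -/
noncomputable def excitation (φ : H) : H →ₗ.[ℂ] H :=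
  ((1 - InnerProductSpace.rankOne ℂ φ φ : H →L[ℂ] H) : H →ₗ[ℂ] H).toPMap ⊤

lemma excitation_apply (φ : H) (ψ : (excitation φ).domain) :
    excitation φ ψ = (1 - InnerProductSpace.rankOne ℂ φ φ : H →L[ℂ] H) ψ := rfl

variable [CompleteSpace H]

/-- The spectral projection of `R` at the isolated spectral value `-2`. -/
lemma exists_projection_of_spectrum {R : H →L[ℂ] H} (hR : IsSelfAdjoint R)
    (hspec : ∀ x ∈ spectrum ℝ R, x = -2 ∨ (0 ≤ x ∧ x ≤ 2)) :
    ∃ Q : H →L[ℂ] H, R * Q = (-2 : ℝ) • Q ∧ 0 ≤ (2 : ℝ) • R - R * R + (8 : ℝ) • Q := by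
  -- Indicator of the isolated point `-2`; the cut at `-1` falls in the spectral gap, so `f` is
  -- continuous on the spectrum.
  set f : ℝ → ℝ := fun x => if x < -1 then 1 else 0 with hf
  have hfc : ContinuousOn f (spectrum ℝ R) := by
    have h₁ : ∀ x ∈ spectrum ℝ R, f =ᶠ[nhdsWithin x (spectrum ℝ R)] fun _ => f x := by
      intro x hx
      rcases hspec x hx with rfl | ⟨h, -⟩
      · filter_upwards [mem_nhdsWithin_of_mem_nhds (Iio_mem_nhds (show (-2 : ℝ) < -1 by norm_num))]
          with y hy
        simp only [hf, Set.mem_Iio] at hy ⊢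
        rw [if_pos hy, if_pos (by norm_num)]
      · filter_upwards [mem_nhdsWithin_of_mem_nhds (Ioi_mem_nhds (show (-1 : ℝ) < x by linarith))]
          with y hy
        simp only [hf, Set.mem_Ioi] at hy ⊢
        rw [if_neg (by linarith), if_neg (by linarith)]
    intro x hx
    exact (continuousWithinAt_const (b := f x)).congr_of_eventuallyEq (h₁ x hx) rfl
  set Q := cfc f R
  have hQ : R * Q = (-2 : ℝ) • Q := by
    calc R * Q = cfc (fun x : ℝ => x * f x) R := by
          rw [cfc_mul (fun x : ℝ => x) f R, cfc_id' ℝ R]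
      _ = cfc (fun x : ℝ => (-2 : ℝ) • f x) R := by
          refine cfc_congr fun x hx => ?_
          rcases hspec x hx with rfl | ⟨h, -⟩
          · simp
          · simp [hf, not_lt.2 (show (-1 : ℝ) ≤ x by linarith)]
      _ = _ := cfc_smul (-2 : ℝ) f R
  -- The constant 8 cancels `2x - x² = -8` at `x = -2`; on `[0, 2]` the polynomial is already
  -- nonnegative.
  have hpos : 0 ≤ (2 : ℝ) • R - R * R + (8 : ℝ) • Q := by
    have : (2 : ℝ) • R - R * R + (8 : ℝ) • Q
        = cfc (fun x : ℝ => (2 : ℝ) • x - x * x + (8 : ℝ) • f x) R := by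
      rw [cfc_add R (fun x : ℝ => (2 : ℝ) • x - x * x) (fun x => (8 : ℝ) • f x),
        cfc_sub (fun x : ℝ => (2 : ℝ) • x) (fun x => x * x) R,
        cfc_smul (8 : ℝ) f R, cfc_smul (2 : ℝ) (fun x : ℝ => x) R, cfc_mul (fun x : ℝ => x) (fun x => x) R,
        cfc_id' ℝ R]
    rw [this]
    refine cfc_nonneg fun x hx => ?_
    rcases hspec x hx with rfl | ⟨h, h'⟩
    · norm_num [hf]
    · simp only [hf, not_lt.2 (show (-1 : ℝ) ≤ x by linarith), if_false, smul_eq_mul]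
      nlinarith
  exact ⟨Q, hQ, hpos⟩

/-- If the spectrum of `R` is contained in `{-2} ∪ [0, 2]` then `R² ≤ 2 R` on the orthogonal
complement of the eigenspace at `-2`. -/
lemma norm_sq_apply_le_of_spectrum {R : H →L[ℂ] H} (hR : IsSelfAdjoint R)
    (hspec : ∀ x ∈ spectrum ℝ R, x = -2 ∨ (0 ≤ x ∧ x ≤ 2)) {v : H}
    (hv : ∀ y, R y = (-2 : ℂ) • y → ⟪v, y⟫_ℂ = 0) :
    ‖R v‖ ^ 2 ≤ 2 * (⟪v, R v⟫_ℂ).re := by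
  obtain ⟨Q, hQ, hpos⟩ := exists_projection_of_spectrum hR hspec
  have hQv : ⟪v, Q v⟫_ℂ = 0 := by
    refine hv _ ?_
    have := congrArg (fun T : H →L[ℂ] H => T v) hQ
    simpa [← Complex.coe_smul] using this
  have h := ((ContinuousLinearMap.nonneg_iff_isPositive _).1 hpos).re_inner_nonneg_right v
  have hRR : ⟪v, R (R v)⟫_ℂ = (‖R v‖ ^ 2 : ℝ) := by
    have hR' : ContinuousLinearMap.adjoint R = R := hR
    rw [← ContinuousLinearMap.adjoint_inner_left, hR']
    simp [inner_self_eq_norm_sq_to_K]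
  simp only [add_apply, sub_apply, mul_apply_eq_comp,
    smul_apply, inner_add_right, inner_sub_right, inner_smul_right_eq_smul,
    hQv, hRR, smul_zero, add_zero, Complex.real_smul, RCLike.re_to_complex, Complex.sub_re,
    Complex.re_ofReal_mul, Complex.ofReal_re] at h
  linarith

/-- An energy observable dominates, as a quadratic form, the projection onto the orthogonal
complement of its vacuum vector. -/
theorem IsEnergyObservable.exists_vacuum {O : H →ₗ.[ℂ] H} (hO : IsEnergyObservable O) :
    ∃ φ : H, ‖φ‖ = 1 ∧
      ∀ ψ : O.domain, ‖(ψ : H)‖ ^ 2 - ‖⟪φ, (ψ : H)⟫_ℂ‖ ^ 2 ≤ (⟪(ψ : H), O ψ⟫_ℂ).re := by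
  have hsymm : ∀ ψ χ : O.domain, ⟪O ψ, (χ : H)⟫_ℂ = ⟪(ψ : H), O χ⟫_ℂ := by
    have h := LinearPMap.adjoint_isFormalAdjoint hO.isSelfAdjoint.dense_domain
    rwa [LinearPMap.isSelfAdjoint_def.1 hO.isSelfAdjoint] at h
  obtain ⟨φ, hφ, hφO, hφspan⟩ : ∃ φ : O.domain, ‖(φ : H)‖ = 1 ∧ O φ = 0 ∧
      ∀ ψ : O.domain, O ψ = 0 → ∃ c : ℂ, ψ = c • φ := by
    obtain ⟨φ₀, h0, hspan⟩ := finrank_eq_one_iff'.1 hO.vacuum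
    have hn : ‖(φ₀ : H)‖ ≠ 0 := by simpa using h0
    refine ⟨((‖(φ₀ : H)‖⁻¹ : ℝ) : ℂ) • (φ₀ : O.domain), ?_, ?_, fun ψ hψ => ?_⟩
    · simp [norm_smul, hn]
    · rw [O.map_smul, show O (φ₀ : O.domain) = 0 from φ₀.2, smul_zero]
    · obtain ⟨c, hc⟩ := hspan ⟨ψ, hψ⟩
      refine ⟨c * ‖(φ₀ : H)‖, ?_⟩
      rw [smul_smul, mul_assoc, ← Complex.ofReal_mul, mul_inv_cancel₀ hn, Complex.ofReal_one,
        mul_one]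
      exact (congrArg Subtype.val hc).symm
  have hbij : ∀ z : ℂ, (z ≠ 0 ∧ ∀ r : ℝ, 1 ≤ r → z ≠ r) →
      Function.Bijective (fun ψ : O.domain => O ψ - z • (ψ : H)) := by
    rintro z ⟨hz0, hz1⟩
    by_contra hz
    rcases hO.gap z hz with h | ⟨r, hr, h⟩
    · exact hz0 h
    · exact hz1 r hr h
  have hhalf := hbij (1 / 2) ⟨by norm_num, fun r hr h => by
    have := congrArg Complex.re h
    norm_num at this
    linarith⟩
  -- Since `1/2` lies in the gap, `R = (O - 1/2)⁻¹` is everywhere defined and symmetric, hence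
  -- bounded (Hellinger–Toeplitz). The map `λ ↦ (λ - 1/2)⁻¹` sends `0` to `-2` and `[1, ∞)` into
  -- `(0, 2]`.
  let T : O.domain ≃ₗ[ℂ] H :=
    LinearEquiv.ofBijective (O.toFun - (1 / 2 : ℂ) • O.domain.subtype) hhalf
  have hT : ∀ ψ, T ψ = O ψ - (1 / 2 : ℂ) • (ψ : H) := fun ψ => rfl
  let R₀ : H →ₗ[ℂ] H := O.domain.subtype ∘ₗ T.symm.toLinearMap
  have hR₀T : ∀ ψ, R₀ (T ψ) = ψ := fun ψ => by simp [R₀]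
  have hR₀ : R₀.IsSymmetric := by
    intro x y
    obtain ⟨ψ, rfl⟩ := T.surjective x
    obtain ⟨χ, rfl⟩ := T.surjective y
    rw [hR₀T, hR₀T, hT, hT, inner_sub_right, inner_sub_left, hsymm, inner_smul_left,
      inner_smul_right, map_div₀, map_one, Complex.conj_ofNat]
  let R : H →L[ℂ] H := ⟨R₀, hR₀.continuous⟩
  have hRT : ∀ ψ, R (T ψ) = ψ := hR₀T
  have hR : IsSelfAdjoint R := ContinuousLinearMap.isSelfAdjoint_iff_isSymmetric.2 hR₀
  have hspec : ∀ x ∈ spectrum ℝ R, x = -2 ∨ (0 ≤ x ∧ x ≤ 2) := by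
    intro μ hμ
    by_contra hcon
    push Not at hcon
    obtain ⟨h2, hnn⟩ := hcon
    have hμ0 : μ ≠ 0 := by rintro rfl; linarith [hnn le_rfl]
    have hb := hbij ((1 / 2 + μ⁻¹ : ℝ) : ℂ) ⟨fun h => ?_, fun r hr h => ?_⟩
    · refine hμ ?_
      rw [spectrum.mem_resolventSet_iff, ContinuousLinearMap.isUnit_iff_bijective]
      refine (Function.Bijective.of_comp_iff _ T.bijective).1 ?_
      have heq : (⇑(algebraMap ℝ (H →L[ℂ] H) μ - R) ∘ ⇑T)
          = (fun y : H => (μ : ℂ) • y) ∘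
            fun ψ : O.domain => O ψ - ((1 / 2 + μ⁻¹ : ℝ) : ℂ) • (ψ : H) := by
        funext ψ
        have hc : (μ : ℂ) ≠ 0 := by exact_mod_cast hμ0
        rw [Function.comp_apply, sub_apply, hRT]
        simp only [Function.comp_apply,
          Algebra.algebraMap_eq_smul_one, smul_apply,
          one_apply_eq_self, ← Complex.coe_smul, hT]
        push_cast
        rw [smul_sub, smul_sub, smul_smul, smul_smul, mul_add, mul_inv_cancel₀ hc, add_smul,
          one_smul]
        abel
      rw [heq]
      exact (MulAction.bijective₀ (by exact_mod_cast hμ0)).comp hb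
    · have h : (1 / 2 + μ⁻¹ : ℝ) = 0 := by exact_mod_cast h
      have : μ⁻¹ = -(1 / 2) := by linarith
      rw [inv_eq_iff_eq_inv] at this
      norm_num at this
      exact h2 this
    · have h : (1 / 2 + μ⁻¹ : ℝ) = r := by exact_mod_cast h
      have h' : 1 / 2 ≤ μ⁻¹ := by linarith
      have hp : 0 < μ := inv_pos.1 (by linarith)
      have := hnn hp.le
      have : μ⁻¹ < 2⁻¹ := inv_strictAnti₀ (by norm_num) this
      linarith
  refine ⟨φ, hφ, fun ψ => ?_⟩
  have hφOψ : ⟪(φ : H), O ψ⟫_ℂ = 0 := by rw [← hsymm, hφO, inner_zero_left]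
  set a := ⟪(φ : H), (ψ : H)⟫_ℂ with ha
  have hφφ : ⟪(φ : H), (φ : H)⟫_ℂ = 1 := by simp [inner_self_eq_norm_sq_to_K, hφ]
  set χ : O.domain := ψ - a • φ with hχ
  have hOχ : O χ = O ψ := by rw [hχ, O.map_sub, O.map_smul, hφO, smul_zero, sub_zero]
  have hφχ : ⟪(φ : H), (χ : H)⟫_ℂ = 0 := by
    rw [hχ, Submodule.coe_sub, Submodule.coe_smul, inner_sub_right, inner_smul_right, hφφ, ← ha,
      mul_one, sub_self]
  have hTφ : ⟪T χ, (φ : H)⟫_ℂ = 0 := by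
    rw [← inner_conj_symm, hT, inner_sub_right, hOχ, hφOψ, inner_smul_right, hφχ]; simp
  -- With `R (T χ) = χ`, the bound `R² ≤ 2R` at `T χ` reads `‖χ‖² ≤ 2⟪χ, (O - 1/2) χ⟫`, that is,
  -- `‖χ‖² ≤ ⟪χ, O χ⟫`.
  have hmain := norm_sq_apply_le_of_spectrum hR hspec (v := T χ) fun y hy => by
    obtain ⟨η, rfl⟩ := T.surjective y
    rw [hRT] at hy
    have hOη : O η = 0 := by
      rw [hT, smul_sub, smul_smul] at hy
      norm_num at hy
      exact hy
    obtain ⟨c, rfl⟩ := hφspan η hOη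
    rw [map_smul, hT φ, hφO, zero_sub, ← neg_smul, smul_smul, inner_smul_right, hTφ, mul_zero]
  have hχn : ‖(χ : H)‖ ^ 2 = ‖(ψ : H)‖ ^ 2 - ‖a‖ ^ 2 := by
    have h : (ψ : H) = χ + a • (φ : H) := by simp [hχ]
    have h₂ := norm_add_sq_eq_norm_sq_add_norm_sq_of_inner_eq_zero (𝕜 := ℂ) (χ : H) (a • (φ : H))
      (by rw [inner_smul_right, ← inner_conj_symm, hφχ]; simp)
    rw [h, norm_smul, hφ, mul_one] at *
    nlinarith
  have hχO : ⟪(χ : H), O ψ⟫_ℂ = ⟪(ψ : H), O ψ⟫_ℂ := by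
    rw [hχ, Submodule.coe_sub, Submodule.coe_smul, inner_sub_left, inner_smul_left, hφOψ, mul_zero,
      sub_zero]
  rw [hRT, hT, hOχ, ← inner_conj_symm, Complex.conj_re, inner_sub_right, hχO,
    inner_smul_right, inner_self_eq_norm_sq_to_K] at hmain
  rw [← hχn]
  have h3 : ((1 / 2 : ℂ) * ((‖(χ : H)‖ : ℂ)) ^ 2).re = ‖(χ : H)‖ ^ 2 / 2 := by
    rw [show (1 / 2 : ℂ) * ((‖(χ : H)‖ : ℂ)) ^ 2 = ((‖(χ : H)‖ ^ 2 / 2 : ℝ) : ℂ) by push_cast; ring]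
    exact Complex.ofReal_re _
  rw [Complex.sub_re] at hmain
  erw [h3] at hmain
  linarith

theorem isEnergyObservable_excitation {φ : H} (hφ : ‖φ‖ = 1) :
    IsEnergyObservable (excitation φ) := by
  have hφφ : ⟪φ, φ⟫_ℂ = 1 := by simp [inner_self_eq_norm_sq_to_K, hφ]
  refine ⟨?_, fun z hz => ?_, ?_⟩
  · rw [LinearPMap.isSelfAdjoint_def, excitation,
      ContinuousLinearMap.toPMap_adjoint_eq_adjoint_toPMap_of_dense _ (by simp)]
    congr 2
    exact ((IsSelfAdjoint.one _).sub
      (InnerProductSpace.isPositive_rankOne_self φ).isSelfAdjoint).star_eq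
  · by_contra hcon
    push Not at hcon
    obtain ⟨hz0, hz1⟩ := hcon
    have hz1 : 1 - z ≠ 0 := fun h => hz1 1 le_rfl (by simpa using (sub_eq_zero.1 h).symm)
    refine hz ?_
    rw [Function.bijective_iff_has_inverse]
    -- The resolvent is `(1 - z)⁻¹` on the complement of `φ` and `-z⁻¹` on its span.
    refine ⟨fun y => ⟨(1 - z)⁻¹ • (y - ⟪φ, y⟫_ℂ • φ) - (z⁻¹ * ⟪φ, y⟫_ℂ) • φ, trivial⟩,
      fun ψ => ?_, fun y => ?_⟩
    · ext
      simp only [excitation_apply, sub_apply, one_apply_eq_self,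
        InnerProductSpace.rankOne_apply, inner_sub_right, inner_smul_right, hφφ]
      match_scalars <;> field_simp
      ring
    · simp only [excitation_apply, sub_apply, one_apply_eq_self,
        InnerProductSpace.rankOne_apply, inner_sub_right, inner_smul_right, hφφ]
      match_scalars <;> field_simp
      ring
  · rw [finrank_eq_one_iff']
    refine ⟨⟨⟨φ, trivial⟩, ?_⟩, ?_, fun ψ => ⟨⟪φ, (ψ : H)⟫_ℂ, ?_⟩⟩
    · change (1 - InnerProductSpace.rankOne ℂ φ φ : H →L[ℂ] H) φ = 0
      simp [hφ]
    · intro h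
      have h' : φ = 0 := congrArg (fun ψ : LinearMap.ker (excitation φ).toFun => (ψ : H)) h
      simp [h'] at hφ
    · have h : (1 - InnerProductSpace.rankOne ℂ φ φ : H →L[ℂ] H) (ψ : H) = 0 := ψ.2
      ext
      simpa [sub_eq_zero, eq_comm] using h

end Energy

/-! ### Gram matrices and the scalar inequalities behind them -/

/-- The symmetric matrix with unit diagonal and off-diagonal entries `E`, `F`, `c` is positive
semidefinite. -/
def IsCorrelationTriple (E F c : ℝ) : Prop :=
  ∀ r s t : ℝ, 0 ≤ r ^ 2 + s ^ 2 + t ^ 2 + 2 * r * s * E + 2 * r * t * F + 2 * s * t * c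

/-- The pairs `(E, ω)` for which there are vectors `b₀`, `b₁` and, for each `x`, a vector `a x`, all
of unit length, with `⟪a x, b₀⟫ = E x` and `⟪a x, b₁⟫ ≤ 2 ω x - 1`; stated through Gram matrices. -/
def gramSet : Set ((Fin 2 → ℝ) × (Fin 2 → ℝ)) :=
  {p | ∃ (F : Fin 2 → ℝ) (c : ℝ),
    ∀ x, IsCorrelationTriple (p.1 x) (F x) c ∧ F x ≤ 2 * p.2 x - 1}

/-- All conditions are affine in `(E, F, c, ω)` jointly, so `c` is averaged along with the rest. -/
lemma convex_gramSet : Convex ℝ gramSet := by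
  rintro p ⟨F, c, hF⟩ p' ⟨F', c', hF'⟩ a b ha hb hab
  refine ⟨a • F + b • F', a * c + b * c', fun x => ⟨fun r s t => ?_, ?_⟩⟩
  · have h := add_nonneg (mul_nonneg ha ((hF x).1 r s t)) (mul_nonneg hb ((hF' x).1 r s t))
    simp only [Prod.fst_add, Prod.smul_fst, Pi.add_apply, Pi.smul_apply, smul_eq_mul]
    obtain rfl : b = 1 - a := by linarith
    linarith
  · have h := add_le_add (mul_le_mul_of_nonneg_left (hF x).2 ha)
      (mul_le_mul_of_nonneg_left (hF' x).2 hb)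
    simp only [Prod.snd_add, Prod.smul_snd, Pi.add_apply, Pi.smul_apply, smul_eq_mul]
    obtain rfl : b = 1 - a := by linarith
    linarith

lemma quadratic_nonneg {X Y D : ℝ} (hX : 0 ≤ X) (hY : 0 ≤ Y) (hD : D ^ 2 ≤ X * Y) (r t : ℝ) :
    0 ≤ r ^ 2 * X + 2 * r * t * D + t ^ 2 * Y := by
  rcases hX.eq_or_lt with rfl | hX
  · have : D = 0 := by nlinarith
    subst this
    nlinarith [mul_nonneg (sq_nonneg t) hY]
  · refine (mul_nonneg_iff_of_pos_left hX).1 ?_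
    nlinarith [sq_nonneg (r * X + t * D), mul_nonneg (sq_nonneg t) (sub_nonneg.2 hD)]

/-- Used with `a = ‖v‖²`, `b = ⟪v, M v⟫`, `m = ⟪φ, M φ⟫`, `p = |⟪φ, v⟫|²`, `q = |⟪M φ, v⟫|²`; then
`q - p - m b` is the form of `alignedObservable` at `v`. -/
lemma correlation_form_nonneg {a b m p q R : ℝ} (hp : 0 ≤ p) (hq : 0 ≤ q) (hR : R ^ 2 ≤ p * q)
    (h₁ : p + q + 2 * R ≤ (1 + m) * (a + b)) (h₂ : p + q - 2 * R ≤ (1 - m) * (a - b))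
    (hm : |m| ≤ 1) (hb : |b| ≤ a) (r s t : ℝ) :
    0 ≤ (r ^ 2 + s ^ 2 + t ^ 2 - 2 * s * t * m) * a + 2 * r * s * b
      + 2 * r * t * (q - p - m * b) := by
  obtain ⟨hm₁, hm₂⟩ := abs_le.1 hm
  obtain ⟨hb₁, hb₂⟩ := abs_le.1 hb
  have hRpq : |2 * R| ≤ p + q := abs_le_of_sq_le_sq (by nlinarith [sq_nonneg (p - q)]) (by linarith)
  obtain ⟨hR₁, hR₂⟩ := abs_le.1 hRpq
  have hX : 0 ≤ a ^ 2 - b ^ 2 := by nlinarith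
  have hY : 0 ≤ 1 - m ^ 2 := by nlinarith
  -- Multiplying `h₁` and `h₂` bounds `(p + q)² - 4R²`, which is at least `(q - p)²` because `R² ≤ p
  -- q`.
  have hD : (q - p) ^ 2 ≤ (a ^ 2 - b ^ 2) * (1 - m ^ 2) := by
    have := mul_le_mul h₁ h₂ (by linarith) (mul_nonneg (by linarith) (by linarith))
    nlinarith
  have ha : 0 ≤ a := (abs_nonneg b).trans hb
  rcases ha.eq_or_lt with rfl | ha
  · obtain rfl : b = 0 := by linarith
    have : q - p = 0 := by nlinarith
    rw [this]
    simp
  -- After multiplication by `a`, completing the square in `s` leaves a binary quadratic form in `r`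
  -- and `t * a`.
  · refine (mul_nonneg_iff_of_pos_left ha).1 ?_
    have := quadratic_nonneg hX hY hD r (t * a)
    nlinarith [sq_nonneg (a * (s - t * m) + r * b)]

/-! ### From prepare-and-measure behaviours to Gram matrices -/

section Realizable

variable {H : Type u} [NormedAddCommGroup H] [InnerProductSpace ℂ H]

lemma re_inner_rankOne_self (x v : H) :
    (⟪v, InnerProductSpace.rankOne ℂ x x v⟫_ℂ).re = ‖⟪x, v⟫_ℂ‖ ^ 2 := by
  rw [InnerProductSpace.rankOne_apply, inner_smul_right, ← inner_conj_symm v x, Complex.mul_conj,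
    Complex.normSq_eq_norm_sq, Complex.ofReal_re]

/-- For a two-outcome observable `M` and a vacuum vector `φ`, the observable that replaces
`1 - 2|φ⟩⟨φ|`: it has fixed overlap with `M`, in every state. -/
noncomputable def alignedObservable (M : H →L[ℂ] H) (φ : H) : H →L[ℂ] H :=
  InnerProductSpace.rankOne ℂ (M φ) (M φ) - InnerProductSpace.rankOne ℂ φ φ
    - (⟪φ, M φ⟫_ℂ).re • M

lemma re_inner_alignedObservable (M : H →L[ℂ] H) (φ v : H) :
    (⟪v, alignedObservable M φ v⟫_ℂ).re =
      ‖⟪M φ, v⟫_ℂ‖ ^ 2 - ‖⟪φ, v⟫_ℂ‖ ^ 2 - (⟪φ, M φ⟫_ℂ).re * (⟪v, M v⟫_ℂ).re := by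
  simp only [alignedObservable, sub_apply, smul_apply, inner_sub_right, Complex.sub_re,
    re_inner_rankOne_self, inner_smul_right_eq_smul, Complex.real_smul, Complex.re_ofReal_mul]

variable [CompleteSpace H]

lemma norm_inner_apply_sq_le {P : H →L[ℂ] H} (hP : 0 ≤ P) (x y : H) :
    ‖⟪x, P y⟫_ℂ‖ ^ 2 ≤ (⟪x, P x⟫_ℂ).re * (⟪y, P y⟫_ℂ).re := by
  set A := CFC.sqrt P
  have hA : ContinuousLinearMap.adjoint A = A := IsSelfAdjoint.of_nonneg (CFC.sqrt_nonneg P)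
  have hAA : A * A = P := CFC.sqrt_mul_sqrt_self P hP
  have h : ∀ x y, ⟪x, P y⟫_ℂ = ⟪A x, A y⟫_ℂ := fun x y => by
    rw [← hAA, mul_apply_eq_comp, ← ContinuousLinearMap.adjoint_inner_left, hA]
  have hn : ∀ x, (⟪A x, A x⟫_ℂ).re = ‖A x‖ ^ 2 := fun x => inner_self_eq_norm_sq (𝕜 := ℂ) _
  rw [h, h, h, hn, hn, ← mul_pow]
  gcongr
  exact norm_inner_le_norm _ _

/-- Cauchy–Schwarz for the positive forms `1 + M` and `1 - M` at the pair `φ`, `v`; `R` is the real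
cross term in `|⟪φ, v⟫ ± ⟪M φ, v⟫|²`. -/
lemma inner_form_le {M : H →L[ℂ] H} (h₁ : -1 ≤ M) (h₂ : M ≤ 1) {φ : H} (hφ : ‖φ‖ = 1) (v : H) :
    ∃ R : ℝ, R ^ 2 ≤ ‖⟪φ, v⟫_ℂ‖ ^ 2 * ‖⟪M φ, v⟫_ℂ‖ ^ 2 ∧
      ‖⟪φ, v⟫_ℂ‖ ^ 2 + ‖⟪M φ, v⟫_ℂ‖ ^ 2 + 2 * R
        ≤ (1 + (⟪φ, M φ⟫_ℂ).re) * (‖v‖ ^ 2 + (⟪v, M v⟫_ℂ).re) ∧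
      ‖⟪φ, v⟫_ℂ‖ ^ 2 + ‖⟪M φ, v⟫_ℂ‖ ^ 2 - 2 * R
        ≤ (1 - (⟪φ, M φ⟫_ℂ).re) * (‖v‖ ^ 2 - (⟪v, M v⟫_ℂ).re) := by
  have hp : 0 ≤ 1 + M := by simpa [add_comm] using sub_nonneg.2 h₁
  have hm : 0 ≤ 1 - M := sub_nonneg.2 h₂
  have hM : ContinuousLinearMap.adjoint M = M := by
    have : IsSelfAdjoint M := by
      simpa using (IsSelfAdjoint.of_nonneg hp).sub (IsSelfAdjoint.one (H →L[ℂ] H))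
    exact this
  have hn : ∀ x : H, (⟪x, x⟫_ℂ).re = ‖x‖ ^ 2 := fun x => inner_self_eq_norm_sq (𝕜 := ℂ) _
  have hMφ : ⟪M φ, v⟫_ℂ = ⟪φ, M v⟫_ℂ := by
    rw [← ContinuousLinearMap.adjoint_inner_left, hM]
  have e₁ := norm_inner_apply_sq_le hp φ v
  have e₂ := norm_inner_apply_sq_le hm φ v
  simp only [add_apply, sub_apply, one_apply_eq_self, inner_add_right, inner_sub_right,
    Complex.add_re, Complex.sub_re, hn, hφ, one_pow] at e₁ e₂
  rw [← hMφ] at e₁ e₂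
  have f₁ := norm_add_sq (𝕜 := ℂ) ⟪φ, v⟫_ℂ ⟪M φ, v⟫_ℂ
  have f₂ := norm_sub_sq (𝕜 := ℂ) ⟪φ, v⟫_ℂ ⟪M φ, v⟫_ℂ
  refine ⟨RCLike.re (inner ℂ ⟪φ, v⟫_ℂ ⟪M φ, v⟫_ℂ), ?_, by linarith, by linarith⟩
  rw [← mul_pow, ← sq_abs]
  gcongr
  exact (RCLike.abs_re_le_norm _).trans (norm_inner_le_norm _ _)

lemma abs_re_inner_le_norm_sq {M : H →L[ℂ] H} (h₁ : -1 ≤ M) (h₂ : M ≤ 1) (v : H) :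
    |(⟪v, M v⟫_ℂ).re| ≤ ‖v‖ ^ 2 := by
  have hn : (⟪v, v⟫_ℂ).re = ‖v‖ ^ 2 := inner_self_eq_norm_sq (𝕜 := ℂ) _
  have e₁ := ((ContinuousLinearMap.nonneg_iff_isPositive _).1
    (sub_nonneg.2 h₁)).re_inner_nonneg_right v
  have e₂ := ((ContinuousLinearMap.nonneg_iff_isPositive _).1
    (sub_nonneg.2 h₂)).re_inner_nonneg_right v
  simp only [sub_apply, neg_apply, one_apply_eq_self, inner_sub_right, inner_neg_right, map_sub,
    map_neg, RCLike.re_to_complex, hn] at e₁ e₂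
  exact abs_le.2 ⟨by linarith, by linarith⟩

/-- The operator `1 - |φ⟩⟨φ|` has a trace against every state, which the mean energy bounds. -/
lemma one_sub_le_of_meanEnergy_le {ρ : H →L[ℂ] H} (hρ : IsState ρ) {O : H →ₗ.[ℂ] H} {φ : H}
    (hφ : ‖φ‖ = 1)
    (hO : ∀ ψ : O.domain, ‖(ψ : H)‖ ^ 2 - ‖⟪φ, (ψ : H)⟫_ℂ‖ ^ 2 ≤ (⟪(ψ : H), O ψ⟫_ℂ).re) {ω : ℝ}
    (h : meanEnergy ρ O ≤ (ω : EReal)) :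
    HasTrace (ρ * InnerProductSpace.rankOne ℂ φ φ) ((⟪φ, ρ φ⟫_ℂ).re : ℂ) ∧
      1 - (⟪φ, ρ φ⟫_ℂ).re ≤ ω := by
  have hre : ((⟪φ, ρ φ⟫_ℂ).re : ℂ) = ⟪φ, ρ φ⟫_ℂ :=
    hρ.isPositive.isSymmetric.coe_re_inner_self_apply φ
  have ht : HasTrace (ρ * InnerProductSpace.rankOne ℂ φ φ) ((⟪φ, ρ φ⟫_ℂ).re : ℂ) := by
    rw [hre]
    exact hasTrace_mul_rankOne φ φ ρ
  refine ⟨ht, EReal.coe_le_coe_iff.1 (le_trans (le_sSup ?_) h)⟩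
  -- By `hO`, this bounded operator is itself a competitor in the supremum defining `meanEnergy`.
  refine ⟨1 - InnerProductSpace.rankOne ℂ φ φ, _, ?_, fun ψ => ?_, ?_, rfl⟩
  · have := (InnerProductSpace.isStarProjection_rankOne_self (𝕜 := ℂ) hφ).one_sub.nonneg
    exact this
  · refine le_trans (le_of_eq ?_) (hO ψ)
    rw [sub_apply, one_apply_eq_self, inner_sub_right, Complex.sub_re, re_inner_rankOne_self]
    congr 1
    exact inner_self_eq_norm_sq (𝕜 := ℂ) _
  · have := hρ.hasTrace_one.sub ht
    rw [mul_sub, mul_one]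
    exact_mod_cast this

end Realizable

theorem realizableBehaviours_subset_gramSet : realizableBehaviours.{u} ⊆ gramSet := by
  rintro ⟨E, ω⟩ ⟨H, _, _, _, ρ, M, O, hρ, -, hM₁, hM₂, hO, hE, hω⟩
  obtain ⟨φ, hφ, hOφ⟩ := hO.exists_vacuum
  have hn : ∀ x : H, (⟪x, x⟫_ℂ).re = ‖x‖ ^ 2 := fun x => inner_self_eq_norm_sq (𝕜 := ℂ) _
  choose g hg₁ hg₂ using fun x => (hρ x).exists_expectation
  have hm : |(⟪φ, M φ⟫_ℂ).re| ≤ 1 := by simpa [hφ] using abs_re_inner_le_norm_sq hM₁ hM₂ φ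
  refine ⟨fun x => g x (alignedObservable M φ), -(⟪φ, M φ⟫_ℂ).re, fun x => ⟨fun r s t => ?_, ?_⟩⟩
  all_goals
    have g1 : g x 1 = 1 := hg₂ x 1 1 (by simpa using (hρ x).hasTrace_one)
    have gM : g x M = E x := hg₂ x M _ (hE x)
  · have := hg₁ x ((r ^ 2 + s ^ 2 + t ^ 2 - 2 * s * t * (⟪φ, M φ⟫_ℂ).re) • (1 : H →L[ℂ] H)
      + (2 * r * s) • M + (2 * r * t) • alignedObservable M φ) fun v => by
        obtain ⟨R, hR, e₁, e₂⟩ := inner_form_le hM₁ hM₂ hφ v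
        have := correlation_form_nonneg (by positivity) (by positivity) hR e₁ e₂ hm
          (abs_re_inner_le_norm_sq hM₁ hM₂ v) r s t
        simpa only [add_apply, smul_apply, one_apply_eq_self, inner_add_right, Complex.add_re,
          inner_smul_right_eq_smul, Complex.real_smul, Complex.re_ofReal_mul, hn,
          re_inner_alignedObservable] using this
    simp only [map_add, map_smul, g1, gM, smul_eq_mul] at this
    linarith
  · obtain ⟨ht, hle⟩ := one_sub_le_of_meanEnergy_le (hρ x) hφ hOφ (hω x)
    have gP := hg₂ x _ _ ht
    -- Adding `e₁` and `e₂` cancels `R` and says exactly that `alignedObservable M φ ≤ 1 - 2|φ⟩⟨φ|`.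
    have := hg₁ x ((1 : H →L[ℂ] H) - (2 : ℝ) • InnerProductSpace.rankOne ℂ φ φ
      - alignedObservable M φ) fun v => by
        obtain ⟨R, hR, e₁, e₂⟩ := inner_form_le hM₁ hM₂ hφ v
        simp only [sub_apply, smul_apply, one_apply_eq_self, inner_sub_right, Complex.sub_re,
          inner_smul_right_eq_smul, Complex.real_smul, Complex.re_ofReal_mul, hn,
          re_inner_alignedObservable, re_inner_rankOne_self]
        linarith
    simp only [map_sub, map_smul, g1, gP, smul_eq_mul] at this
    linarith

theorem quantumSet_subset_gramSet : quantumSet.{u} ⊆ gramSet :=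
  convexHull_min realizableBehaviours_subset_gramSet convex_gramSet

/-! ### From Bell behaviours to Gram matrices -/

section Tensor

variable {HA : Type v} {HB : Type w} [NormedAddCommGroup HA] [InnerProductSpace ℂ HA]
  [NormedAddCommGroup HB] [InnerProductSpace ℂ HB]

lemma tensorOp_coe (A : HA →L[ℂ] HA) (B : HB →L[ℂ] HB) (x : HA ⊗[ℂ] HB) :
    tensorOp A B (x : HilbertTensor HA HB)
      = ((TensorProduct.mapL A B x : HA ⊗[ℂ] HB) : HilbertTensor HA HB) :=
  ContinuousLinearMap.completion_apply_coe _ _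

lemma tensorOp_mul (A A' : HA →L[ℂ] HA) (B B' : HB →L[ℂ] HB) :
    tensorOp A B * tensorOp A' B' = tensorOp (A * A') (B * B') := by
  ext x
  induction x using UniformSpace.Completion.induction_on with
  | hp => exact isClosed_eq (ContinuousLinearMap.continuous _) (ContinuousLinearMap.continuous _)
  | ih x => rw [mul_apply_eq_comp, tensorOp_coe, tensorOp_coe, tensorOp_coe,
      TensorProduct.mapL_mul, mul_apply_eq_comp]

lemma tensorOp_one_one : tensorOp (1 : HA →L[ℂ] HA) (1 : HB →L[ℂ] HB) = 1 := by
  ext x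
  induction x using UniformSpace.Completion.induction_on with
  | hp => exact isClosed_eq (ContinuousLinearMap.continuous _) (ContinuousLinearMap.continuous _)
  | ih x =>
    rw [tensorOp_coe, one_apply_eq_self]
    congr 1
    exact congrArg (fun T : HA ⊗[ℂ] HB →L[ℂ] HA ⊗[ℂ] HB => T x) TensorProduct.mapL_id_id

variable [CompleteSpace HA] [CompleteSpace HB]

lemma isSelfAdjoint_tensorOp {A : HA →L[ℂ] HA} {B : HB →L[ℂ] HB} (hA : IsSelfAdjoint A)
    (hB : IsSelfAdjoint B) : IsSelfAdjoint (tensorOp A B) := by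
  rw [ContinuousLinearMap.isSelfAdjoint_iff_isSymmetric]
  have hA' := ContinuousLinearMap.isSelfAdjoint_iff_isSymmetric.1 hA
  have hB' := ContinuousLinearMap.isSelfAdjoint_iff_isSymmetric.1 hB
  have key : ∀ x y : HA ⊗[ℂ] HB,
      ⟪TensorProduct.mapL A B x, y⟫_ℂ = ⟪x, TensorProduct.mapL A B y⟫_ℂ := by
    intro x y
    induction x with
    | zero => simp
    | add x x' hx hx' => rw [map_add, inner_add_left, inner_add_left, hx, hx']
    | tmul a b =>
      induction y with
      | zero => simp
      | add y y' hy hy' => rw [map_add, inner_add_right, inner_add_right, hy, hy']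
      | tmul a' b' =>
        rw [TensorProduct.mapL_tmul, TensorProduct.mapL_tmul, TensorProduct.inner_tmul,
          TensorProduct.inner_tmul]
        exact congrArg₂ (· * ·) (hA' a a') (hB' b b')
  intro x y
  change ⟪tensorOp A B x, y⟫_ℂ = ⟪x, tensorOp A B y⟫_ℂ
  induction x, y using UniformSpace.Completion.induction_on₂ with
  | hp => exact isClosed_eq (by fun_prop) (by fun_prop)
  | ih x y =>
    rw [tensorOp_coe, tensorOp_coe, UniformSpace.Completion.inner_coe,
      UniformSpace.Completion.inner_coe, key]

end Tensor

/-- A positive functional turns a self-adjoint involution commuting with two others into a positive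
semidefinite correlation matrix. -/
lemma isCorrelationTriple_of_involutions {H : Type u} [NormedAddCommGroup H]
    [InnerProductSpace ℂ H] [CompleteSpace H] {g : (H →L[ℂ] H) →ₗ[ℝ] ℝ}
    (hg : ∀ T, (∀ v, 0 ≤ (⟪v, T v⟫_ℂ).re) → 0 ≤ g T) (g1 : g 1 = 1) {X Y Z : H →L[ℂ] H}
    (hX : IsSelfAdjoint X) (hY : IsSelfAdjoint Y) (hZ : IsSelfAdjoint Z) (hXX : X * X = 1)
    (hYY : Y * Y = 1) (hZZ : Z * Z = 1) (hYX : Y * X = X * Y) (hZX : Z * X = X * Z) :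
    IsCorrelationTriple (g (X * Y)) (g (X * Z)) (g (Y * Z + Z * Y) / 2) := by
  intro r s t
  set K := r • X + s • Y + t • Z with hK
  have hKs : IsSelfAdjoint K := by
    have h₁ : IsSelfAdjoint (r • X) := (IsSelfAdjoint.all r).smul hX
    have h₂ : IsSelfAdjoint (s • Y) := (IsSelfAdjoint.all s).smul hY
    have h₃ : IsSelfAdjoint (t • Z) := (IsSelfAdjoint.all t).smul hZ
    exact (h₁.add h₂).add h₃
  -- `X` commutes with `Y` and `Z`, but `Y` and `Z` need not commute, so their anticommutator
  -- remains.
  have hKK : K * K = (r ^ 2 + s ^ 2 + t ^ 2) • 1 + (2 * r * s) • (X * Y)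
      + (2 * r * t) • (X * Z) + (s * t) • (Y * Z + Z * Y) := by
    simp only [hK, mul_add, add_mul, smul_mul_smul_comm, hXX, hYY, hZZ, hYX, hZX]
    module
  have hpos : 0 ≤ g (K * K) := hg _ fun v => by
    have h : ContinuousLinearMap.adjoint K = K := hKs
    rw [mul_apply_eq_comp, ← ContinuousLinearMap.adjoint_inner_left, h]
    exact inner_self_nonneg (𝕜 := ℂ)
  rw [hKK] at hpos
  simp only [map_add, map_smul, g1, smul_eq_mul] at hpos ⊢
  linarith

theorem mem_gramSet_of_bell {E ω : Fin 2 → ℝ} {C : Fin 2 → Fin 2 → ℝ}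
    (hC : C ∈ bellQuantumSet.{v, w}) (hE : ∀ x, C x 0 = E x) (hω : ∀ x, C x 1 ≤ 2 * ω x - 1) :
    (E, ω) ∈ gramSet := by
  obtain ⟨HA, _, _, _, HB, _, _, _, ρ, A, B, hρ, hA, hB, hC⟩ := hC
  obtain ⟨g, hg₁, hg₂⟩ := hρ.exists_expectation
  have g1 : g 1 = 1 := hg₂ 1 1 (by simpa using hρ.hasTrace_one)
  -- This `c` involves only the state and Bob's observables, hence is the same for both `x`.
  refine ⟨fun x => C x 1, g (tensorOp 1 (B 0) * tensorOp 1 (B 1)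
    + tensorOp 1 (B 1) * tensorOp 1 (B 0)) / 2, fun x => ⟨?_, hω x⟩⟩
  have h := isCorrelationTriple_of_involutions hg₁ g1
    (isSelfAdjoint_tensorOp (hA x).1 (.one _)) (isSelfAdjoint_tensorOp (.one _) (hB 0).1)
    (isSelfAdjoint_tensorOp (.one _) (hB 1).1)
    (by rw [tensorOp_mul, ← sq, (hA x).2, mul_one, tensorOp_one_one])
    (by rw [tensorOp_mul, ← sq (B 0), (hB 0).2, mul_one, tensorOp_one_one])
    (by rw [tensorOp_mul, ← sq (B 1), (hB 1).2, mul_one, tensorOp_one_one])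
    (by simp only [tensorOp_mul, mul_one, one_mul]) (by simp only [tensorOp_mul, mul_one, one_mul])
  rw [tensorOp_mul (A x), tensorOp_mul (A x), mul_one, one_mul, one_mul, hg₂ _ _ (hC x 0),
    hg₂ _ _ (hC x 1), hE] at h
  exact h

/-- Three unit vectors on the sphere, in coordinates adapted to the last two. -/
lemma IsCorrelationTriple.exists_angle {E F c : ℝ} (h : IsCorrelationTriple E F c) :
    c ^ 2 ≤ 1 ∧ F ^ 2 ≤ 1 ∧
      ∃ k : ℝ, k ^ 2 ≤ 1 ∧ E = c * F + √(1 - c ^ 2) * √(1 - F ^ 2) * k := by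
  have hc : 0 ≤ 1 - c ^ 2 := by nlinarith [h 0 1 (-c)]
  have hF : 0 ≤ 1 - F ^ 2 := by nlinarith [h 1 0 (-F)]
  have hdet : (E - c * F) ^ 2 ≤ (1 - c ^ 2) * (1 - F ^ 2) := by
    -- For unit vectors `a`, `b₀`, `b₁` with overlaps `E`, `F`, `c`: if `c² = 1`, then `b₀ - c b₁`
    -- is null and must be orthogonal to `a`. Otherwise the coefficients give `1 - c²` times the
    -- part of `a` orthogonal to `b₀` and `b₁`.
    rcases hc.eq_or_lt with h0 | hpos
    · have h₁ := h (E - c * F) (-1) c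
      nlinarith
    · have h₁ := h (1 - c ^ 2) (c * F - E) (c * E - F)
      have h₂ : 0 ≤ (1 - c ^ 2) * ((1 - c ^ 2) * (1 - F ^ 2) - (E - c * F) ^ 2) := by
        convert h₁ using 1; ring
      exact sub_nonneg.1 ((mul_nonneg_iff_of_pos_left hpos).1 h₂)
  refine ⟨sub_nonneg.1 hc, sub_nonneg.1 hF, ?_⟩
  -- Spherical law of cosines: `k` is the cosine of the dihedral angle, set to `0` in the degenerate
  -- case.
  set d := √(1 - c ^ 2) * √(1 - F ^ 2) with hd
  have hd2 : d ^ 2 = (1 - c ^ 2) * (1 - F ^ 2) := by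
    rw [hd, mul_pow, Real.sq_sqrt hc, Real.sq_sqrt hF]
  by_cases hd0 : d = 0
  · refine ⟨0, by norm_num, ?_⟩
    have : (E - c * F) ^ 2 ≤ 0 := by rw [← hd2, hd0] at hdet; simpa using hdet
    nlinarith
  · refine ⟨(E - c * F) / d, ?_, by field_simp; ring⟩
    rw [div_pow, div_le_one (by positivity), hd2]
    exact hdet

/-! ### Qubit realisations of Gram matrices -/

section MaximallyEntangled

lemma norm_eq_one_of_inner_self {H : Type u} [NormedAddCommGroup H] [InnerProductSpace ℂ H] {x : H}
    (h : ⟪x, x⟫_ℂ = 1) : ‖x‖ = 1 := by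
  have h₁ := inner_self_eq_norm_sq (𝕜 := ℂ) x
  rw [h, RCLike.one_re] at h₁
  nlinarith [norm_nonneg x]

variable {HA : Type v} {HB : Type w} [NormedAddCommGroup HA] [InnerProductSpace ℂ HA]
  [NormedAddCommGroup HB] [InnerProductSpace ℂ HB]

/-- The vector `(e 0 ⊗ f 0 + e 1 ⊗ f 1) / √2`. -/
noncomputable def maxEntangled (e : Fin 2 → HA) (f : Fin 2 → HB) : HilbertTensor HA HB :=
  (((√2)⁻¹ : ℝ) : ℂ) • ((e 0 ⊗ₜ[ℂ] f 0 + e 1 ⊗ₜ[ℂ] f 1 : HA ⊗[ℂ] HB) : HilbertTensor HA HB)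

lemma inner_maxEntangled (e : Fin 2 → HA) (f : Fin 2 → HB) (A : HA →L[ℂ] HA) (B : HB →L[ℂ] HB) :
    ⟪maxEntangled e f, tensorOp A B (maxEntangled e f)⟫_ℂ =
      (∑ i, ∑ j, ⟪e i, A (e j)⟫_ℂ * ⟪f i, B (f j)⟫_ℂ) / 2 := by
  have hsq : (((√2)⁻¹ : ℝ) : ℂ) * (((√2)⁻¹ : ℝ) : ℂ) = 1 / 2 := by
    rw [← Complex.ofReal_mul, ← mul_inv, Real.mul_self_sqrt (by norm_num)]
    norm_num
  rw [maxEntangled, map_smul, inner_smul_left, inner_smul_right, Complex.conj_ofReal, ← mul_assoc,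
    hsq, tensorOp_coe, UniformSpace.Completion.inner_coe]
  simp only [map_add, TensorProduct.mapL_tmul, inner_add_left, inner_add_right,
    TensorProduct.inner_tmul, Fin.sum_univ_two]
  ring

lemma norm_maxEntangled {e : Fin 2 → HA} {f : Fin 2 → HB} (he : Orthonormal ℂ e)
    (hf : Orthonormal ℂ f) : ‖maxEntangled e f‖ = 1 := by
  refine norm_eq_one_of_inner_self ?_
  have h := inner_maxEntangled e f 1 1
  rw [tensorOp_one_one] at h
  simpa [orthonormal_iff_ite.1 he, orthonormal_iff_ite.1 hf, -inner_self_eq_norm_sq_to_K] using h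

end MaximallyEntangled

section Qubit

/-- The Hilbert space `ℂ²`, in an arbitrary universe. -/
abbrev Qubit : Type u := EuclideanSpace ℂ (ULift.{u} (Fin 2))

/-- The vector of `ℂ²` with the given coordinates. -/
noncomputable def qubitVec (a b : ℂ) : Qubit.{u} := WithLp.toLp 2 fun i => ![a, b] i.down

/-- The operator on `ℂ²` with the given matrix. -/
noncomputable def qubitOp (M : Matrix (Fin 2) (Fin 2) ℂ) : Qubit.{u} →L[ℂ] Qubit.{u} :=
  Matrix.toEuclideanCLM (n := ULift.{u} (Fin 2)) (𝕜 := ℂ) (M.submatrix ULift.down ULift.down)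

lemma inner_qubitVec (a b c d : ℂ) :
    ⟪qubitVec.{u} a b, qubitVec c d⟫_ℂ = star a * c + star b * d := by
  rw [PiLp.inner_apply, ← Equiv.ulift.symm.sum_comp]
  simp [qubitVec, Fin.sum_univ_two, mul_comm]

lemma qubitOp_qubitVec (M : Matrix (Fin 2) (Fin 2) ℂ) (a b : ℂ) :
    qubitOp.{u} M (qubitVec a b)
      = qubitVec (M 0 0 * a + M 0 1 * b) (M 1 0 * a + M 1 1 * b) := by
  rw [qubitOp, qubitVec, Matrix.toEuclideanCLM_toLp]
  ext ⟨i⟩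
  change (M.submatrix ULift.down ULift.down).mulVec (fun i => ![a, b] i.down) ⟨i⟩ = _
  rw [Matrix.mulVec, dotProduct, ← Equiv.ulift.symm.sum_comp]
  fin_cases i <;> simp [qubitVec, Fin.sum_univ_two]

lemma isSelfAdjoint_qubitOp {M : Matrix (Fin 2) (Fin 2) ℂ} (hM : M.IsHermitian) :
    IsSelfAdjoint (qubitOp.{u} M) := by
  rw [IsSelfAdjoint, qubitOp, ← map_star, Matrix.star_eq_conjTranspose,
    Matrix.conjTranspose_submatrix, hM]

lemma qubitOp_sq {M : Matrix (Fin 2) (Fin 2) ℂ} (hM : M * M = 1) : qubitOp.{u} M ^ 2 = 1 := by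
  rw [sq, qubitOp, ← map_mul]
  erw [Matrix.submatrix_mul_equiv M M ULift.down Equiv.ulift ULift.down]
  rw [hM, Matrix.submatrix_one _ ULift.down_injective, map_one]

lemma norm_qubitVec {a b : ℂ} (h : Complex.normSq a + Complex.normSq b = 1) :
    ‖qubitVec.{u} a b‖ = 1 := by
  refine norm_eq_one_of_inner_self ?_
  rw [inner_qubitVec, Complex.star_def, ← Complex.normSq_eq_conj_mul_self,
    ← Complex.normSq_eq_conj_mul_self, ← Complex.ofReal_add, h, Complex.ofReal_one]

/-- The standard basis of `ℂ²`. -/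
noncomputable def qubitBasis : Fin 2 → Qubit.{u} := ![qubitVec 1 0, qubitVec 0 1]

lemma orthonormal_qubitBasis : Orthonormal ℂ qubitBasis.{u} := by
  rw [orthonormal_iff_ite]
  intro i j
  fin_cases i <;> fin_cases j <;> simp [qubitBasis, inner_qubitVec, -inner_self_eq_norm_sq_to_K]

lemma inner_qubitBasis (M : Matrix (Fin 2) (Fin 2) ℂ) (i j : Fin 2) :
    ⟪qubitBasis.{u} i, qubitOp M (qubitBasis j)⟫_ℂ = M i j := by
  fin_cases i <;> fin_cases j <;> simp [qubitBasis, qubitOp_qubitVec, inner_qubitVec]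

/-- A Hermitian traceless matrix whose Bloch vector has squared length `x² + |z|²`. -/
def blochMatrix (x : ℝ) (z : ℂ) : Matrix (Fin 2) (Fin 2) ℂ := !![(x : ℂ), z; star z, -(x : ℂ)]

lemma isHermitian_blochMatrix (x : ℝ) (z : ℂ) : (blochMatrix x z).IsHermitian := by
  ext i j
  fin_cases i <;> fin_cases j <;> simp [blochMatrix]

lemma blochMatrix_mul_self {x : ℝ} {z : ℂ} (h : x ^ 2 + Complex.normSq z = 1) :
    blochMatrix x z * blochMatrix x z = 1 := by
  have h' : (x : ℂ) * x + z * (starRingEnd ℂ) z = 1 := by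
    rw [Complex.mul_conj]
    exact_mod_cast (by linarith : x * x + Complex.normSq z = 1)
  ext i j
  fin_cases i <;> fin_cases j <;> simp [blochMatrix, Matrix.mul_apply, Fin.sum_univ_two]
  · exact h'
  · ring
  · ring
  · linear_combination h'

end Qubit

section Energy

variable {H : Type u} [NormedAddCommGroup H] [InnerProductSpace ℂ H]

lemma inner_one_sub_rankOne (φ v : H) :
    ⟪v, (1 - InnerProductSpace.rankOne ℂ φ φ : H →L[ℂ] H) v⟫_ℂ
      = ⟪v, v⟫_ℂ - ⟪φ, v⟫_ℂ * ⟪v, φ⟫_ℂ := by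
  rw [sub_apply, one_apply_eq_self, InnerProductSpace.rankOne_apply, inner_sub_right,
    inner_smul_right]

variable [CompleteSpace H]

/-- The domain is all of `H`, so every competitor `B` satisfies `B ≤ 1 - |φ⟩⟨φ|` and positivity of
the state compares the traces. -/
lemma meanEnergy_excitation_le {ρ : H →L[ℂ] H} (hρ : IsState ρ) {φ : H} {t : ℝ}
    (ht : HasTrace (ρ * (1 - InnerProductSpace.rankOne ℂ φ φ)) (t : ℂ)) :
    meanEnergy ρ (excitation φ) ≤ (t : EReal) := by
  obtain ⟨g, hg₁, hg₂⟩ := hρ.exists_expectation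
  refine sSup_le ?_
  rintro _ ⟨B, r, -, hB, hr, rfl⟩
  have h := hg₁ (1 - InnerProductSpace.rankOne ℂ φ φ - B) fun v => by
    have := hB ⟨v, trivial⟩
    rw [excitation_apply] at this
    rw [sub_apply, inner_sub_right, Complex.sub_re]
    exact sub_nonneg.2 this
  rw [map_sub, hg₂ _ _ ht, hg₂ _ _ hr] at h
  exact EReal.coe_le_coe_iff.2 (sub_nonneg.1 h)

/-- `(1 ± M)² = 2(1 ± M)`, so both are half a square. -/
lemma neg_one_le_and_le_one_of_sq_eq_one {M : H →L[ℂ] H} (hM : IsSelfAdjoint M) (h : M ^ 2 = 1) :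
    -1 ≤ M ∧ M ≤ 1 := by
  rw [sq] at h
  have h1 : IsSelfAdjoint (1 : H →L[ℂ] H) := .one _
  constructor
  · have e : M - -1 = (2⁻¹ : ℝ) • ((1 + M) * (1 + M)) := by
      rw [mul_add, add_mul, add_mul, h, mul_one, one_mul, mul_one]; module
    rw [← sub_nonneg, e]
    exact smul_nonneg (by norm_num) (h1.add hM).mul_self_nonneg
  · have e : 1 - M = (2⁻¹ : ℝ) • ((1 - M) * (1 - M)) := by
      rw [mul_sub, sub_mul, sub_mul, h, mul_one, one_mul, mul_one]; module
    rw [← sub_nonneg, e]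
    exact smul_nonneg (by norm_num) (h1.sub hM).mul_self_nonneg

end Energy

/-- `k` and `√(1 - k²)` serve as cosine and sine of a phase. -/
lemma normSq_phase {k : ℝ} (hk : k ^ 2 ≤ 1) (d : ℝ) :
    Complex.normSq (⟨d * k, d * √(1 - k ^ 2)⟩ : ℂ) = d ^ 2 := by
  rw [Complex.normSq_mk]
  linear_combination d ^ 2 * Real.mul_self_sqrt (sub_nonneg.2 hk)

theorem gramSet_subset_quantumSet : gramSet ⊆ quantumSet.{u} := by
  rintro ⟨E, ω⟩ ⟨F, c, h⟩
  -- No shared randomness is needed.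
  refine subset_convexHull ℝ _ ?_
  have hc : c ^ 2 ≤ 1 := (h 0).1.exists_angle.1
  choose hF k hk hE using fun x => (h x).1.exists_angle.2
  -- The state `(α, β)` has excitation probability `|β|² = (1 + F x) / 2 ≤ ω x`; its relative phase
  -- has cosine `k x`.
  set α : Fin 2 → ℝ := fun x => √((1 - F x) / 2)
  set β : Fin 2 → ℂ := fun x =>
    ⟨√((1 + F x) / 2) * k x, √((1 + F x) / 2) * √(1 - k x ^ 2)⟩
  have hα : ∀ x, α x * α x = (1 - F x) / 2 := fun x =>
    Real.mul_self_sqrt (by nlinarith [hF x])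
  have hβ : ∀ x, Complex.normSq (β x) = (1 + F x) / 2 := fun x => by
    rw [normSq_phase (hk x), Real.sq_sqrt (by nlinarith [hF x])]
  have hαβ : ∀ x, 2 * (α x * (β x).re) = √(1 - F x ^ 2) * k x := fun x => by
    have : √(1 - F x ^ 2) = 2 * (√((1 - F x) / 2) * √((1 + F x) / 2)) := by
      rw [← Real.sqrt_mul (by nlinarith [hF x]), show (1 - F x) / 2 * ((1 + F x) / 2)
        = (1 - F x ^ 2) / 2 ^ 2 by ring, Real.sqrt_div' _ (by norm_num), Real.sqrt_sq (by norm_num)]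
      ring
    rw [this]
    simp only [α, β]
    ring
  set χ : Fin 2 → Qubit.{u} := fun x => qubitVec (α x) (β x)
  have hχ : ∀ x, ‖χ x‖ = 1 := fun x => norm_qubitVec (by
    rw [hβ, Complex.normSq_ofReal, hα]; ring)
  set φ : Qubit.{u} := qubitVec 1 0
  have hφ : ‖φ‖ = 1 := norm_qubitVec (by simp)
  -- This `M` gives `⟨M⟩ = c(|β|² - α²) + 2√(1 - c²) α Re β`, which is `exists_angle`'s formula for
  -- `E x`.
  set M := qubitOp.{u} (blochMatrix (-c) (√(1 - c ^ 2) : ℝ))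
  have hM : IsSelfAdjoint M := isSelfAdjoint_qubitOp (isHermitian_blochMatrix _ _)
  have hM2 : M ^ 2 = 1 := qubitOp_sq (blochMatrix_mul_self (by
    rw [Complex.normSq_ofReal, Real.mul_self_sqrt (sub_nonneg.2 hc)]; ring))
  obtain ⟨hM₁, hM₂⟩ := neg_one_le_and_le_one_of_sq_eq_one hM hM2
  refine ⟨Qubit.{u}, inferInstance, inferInstance, inferInstance,
    fun x => InnerProductSpace.rankOne ℂ (χ x) (χ x), M, excitation φ,
    fun x => isState_rankOne (hχ x), hM, hM₁, hM₂, isEnergyObservable_excitation hφ,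
    fun x => ?_, fun x => ?_⟩
  · have h₁ := hasTrace_rankOne_mul (χ x) (χ x) M
    convert h₁ using 1
    rw [qubitOp_qubitVec, inner_qubitVec]
    have hE' : (E x : ℂ) = c * F x + (√(1 - c ^ 2) : ℝ) * (√(1 - F x ^ 2) * k x : ℝ) := by
      rw [show E x = _ from hE x]; push_cast; ring
    have hα' : (α x : ℂ) * α x = (1 - F x) / 2 := by exact_mod_cast congrArg Complex.ofReal (hα x)
    have hβ' : (starRingEnd ℂ) (β x) * β x = (1 + F x) / 2 := by
      rw [← Complex.normSq_eq_conj_mul_self, hβ]; push_cast; rfl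
    have hre := Complex.add_conj (β x)
    have hαβ' : (2 : ℂ) * (α x * (β x).re) = (√(1 - F x ^ 2) * k x : ℝ) := by
      exact_mod_cast congrArg Complex.ofReal (hαβ x)
    push_cast at hre
    simp only [blochMatrix, Matrix.of_apply, Matrix.cons_val', Matrix.cons_val_zero,
      Matrix.cons_val_one, Matrix.cons_val_fin_one, Complex.star_def, Complex.conj_ofReal,
      Complex.ofReal_neg]
    linear_combination hE' + c * hα' - c * hβ' - (√(1 - c ^ 2) : ℝ) * α x * hre
      - (√(1 - c ^ 2) : ℝ) * hαβ'
  · refine (meanEnergy_excitation_le (t := (1 + F x) / 2) (isState_rankOne (hχ x)) ?_).trans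
      (EReal.coe_le_coe_iff.2 (by linarith [(h x).2]))
    have h₁ := hasTrace_rankOne_mul (χ x) (χ x) (1 - InnerProductSpace.rankOne ℂ φ φ)
    convert h₁ using 1
    have hβ' : (starRingEnd ℂ) (β x) * β x = (1 + F x) / 2 := by
      rw [← Complex.normSq_eq_conj_mul_self, hβ]; push_cast; rfl
    rw [inner_one_sub_rankOne]
    simp only [χ, φ, inner_qubitVec, Complex.star_def, Complex.conj_ofReal, map_one, map_zero]
    push_cast
    linear_combination -hβ'

theorem exists_bell_of_mem_gramSet {E ω : Fin 2 → ℝ} (h : (E, ω) ∈ gramSet) :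
    ∃ C ∈ bellQuantumSet.{v, w}, (∀ x, C x 0 = E x) ∧ ∀ x, C x 1 ≤ 2 * ω x - 1 := by
  obtain ⟨F, c, h⟩ := h
  have hc : c ^ 2 ≤ 1 := (h 0).1.exists_angle.1
  choose hF k hk hE using fun x => (h x).1.exists_angle.2
  set z : Fin 2 → ℂ := fun x => ⟨√(1 - F x ^ 2) * k x, √(1 - F x ^ 2) * √(1 - k x ^ 2)⟩
  have hz : ∀ x, Complex.normSq (z x) = 1 - F x ^ 2 := fun x => by
    rw [normSq_phase (hk x), Real.sq_sqrt (sub_nonneg.2 (hF x))]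
  set a : Fin 2 → Matrix (Fin 2) (Fin 2) ℂ := fun x => blochMatrix (F x) (z x)
  -- On the maximally entangled state the correlator is `Tr[a bᵀ] / 2`. Both matrices `b y` are real
  -- symmetric, so this is the dot product of Bloch vectors.
  set b : Fin 2 → Matrix (Fin 2) (Fin 2) ℂ :=
    ![blochMatrix c (√(1 - c ^ 2) : ℝ), blochMatrix 1 0]
  have hb : ∀ y, (b y).IsHermitian ∧ b y * b y = 1 := by
    intro y
    fin_cases y
    · refine ⟨isHermitian_blochMatrix _ _, blochMatrix_mul_self ?_⟩
      rw [Complex.normSq_ofReal, Real.mul_self_sqrt (sub_nonneg.2 hc)]; ring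
    · exact ⟨isHermitian_blochMatrix _ _, blochMatrix_mul_self (by simp)⟩
  set Φ : HilbertTensor Qubit.{v} Qubit.{w} := maxEntangled qubitBasis qubitBasis
  have hΦ : ‖Φ‖ = 1 := norm_maxEntangled orthonormal_qubitBasis orthonormal_qubitBasis
  refine ⟨fun x => ![E x, F x], ⟨Qubit.{v}, inferInstance, inferInstance, inferInstance,
    Qubit.{w}, inferInstance, inferInstance, inferInstance, InnerProductSpace.rankOne ℂ Φ Φ,
    fun x => qubitOp (a x), fun y => qubitOp (b y), isState_rankOne hΦ,
    fun x => ⟨isSelfAdjoint_qubitOp (isHermitian_blochMatrix _ _),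
      qubitOp_sq (blochMatrix_mul_self (by rw [hz]; ring))⟩,
    fun y => ⟨isSelfAdjoint_qubitOp (hb y).1, qubitOp_sq (hb y).2⟩, fun x y => ?_⟩,
    fun x => rfl, fun x => (h x).2⟩
  have h₁ := hasTrace_rankOne_mul Φ Φ (tensorOp (qubitOp (a x)) (qubitOp (b y)))
  rw [inner_maxEntangled] at h₁
  simp only [inner_qubitBasis, Fin.sum_univ_two] at h₁
  convert h₁ using 1
  have hre : z x + (starRingEnd ℂ) (z x) = 2 * ((√(1 - F x ^ 2) * k x : ℝ) : ℂ) := by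
    rw [Complex.add_conj]; simp [z]
  fin_cases y
  · simp [a, b, blochMatrix]
    have hE' : (E x : ℂ) = c * F x + (√(1 - c ^ 2) : ℝ) * (√(1 - F x ^ 2) * k x : ℝ) := by
      rw [show E x = _ from hE x]; push_cast; ring
    linear_combination hE' - (√(1 - c ^ 2) : ℝ) / 2 * hre
  · simp [a, b, blochMatrix]

end EnergyCorrelations

theorem proposition7 (E ω : Fin 2 → ℝ) :
    (E, ω) ∈ EnergyCorrelations.quantumSet.{u} ↔
      ∃ C ∈ EnergyCorrelations.bellQuantumSet.{v, w},
        (∀ x, C x 0 = E x) ∧ ∀ x, C x 1 ≤ 2 * ω x - 1 :=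
  ⟨fun h => EnergyCorrelations.exists_bell_of_mem_gramSet
    (EnergyCorrelations.quantumSet_subset_gramSet h), fun ⟨_, hC, hE, hω⟩ =>
    EnergyCorrelations.gramSet_subset_quantumSet (EnergyCorrelations.mem_gramSet_of_bell hC hE hω)⟩
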